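/- For a bounded open set $\Omega\subset\mathbb{R}^2$ let $\widehat{\chi_\Omega}(\xi)=\int_\Omega e^{i\xi\cdot x}\,dx$, $\xi\in\mathbb{R}^2$, be the Fourier transform of its characteristic function, and let $$\kappa(\Omega)=\inf\{|\xi| : \xi\in\mathbb{R}^2,\ \widehat{\chi_\Omega}(\xi)=0\}\in[0,\infty]$$ be the distance from the origin to its set of real zeros ($\kappa(\Omega)=\infty$ if there are no real zeros). Let $\Omega^*$ be the open disk centred at the origin with the same area as $\Omega$, let $J_n$ be the Bessel function of the first kind of order $n$, and let $j_{n,1}$ be its first positive zero. **Theorem.** Let $$C=\frac{2j_{0,1}}{j_{1,1}}\approx 1.2552 .$$ Then for every non-empty bounded open convex set $\Omega\subset\mathbb{R}^2$ that is balanced, i.e. invariant under $x\mapsto -x$, $$\kappa(\Omega)\le C\,\kappa(\Omega^*).$$ -/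

import Mathlib

open MeasureTheory

noncomputable section

/-- The Fourier transform of the characteristic function of `Ω ⊆ ℝᵈ` at a real frequency `ξ`:
`∫_Ω exp (i ξ·x) dx`. -/
def charFourier {d : ℕ} (Ω : Set (EuclideanSpace ℝ (Fin d))) (ξ : EuclideanSpace ℝ (Fin d)) : ℂ :=
  ∫ x in Ω, Complex.exp (Complex.I * ((inner ℝ ξ x : ℝ) : ℂ))

/-- The real null variety of `Ω`: the real zeros of the Fourier transform of its characteristic
function. -/
def realNullVariety {d : ℕ} (Ω : Set (EuclideanSpace ℝ (Fin d))) :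
    Set (EuclideanSpace ℝ (Fin d)) :=
  {ξ | charFourier Ω ξ = 0}

/-- `κ(Ω)`: the distance from the origin to the real null variety, with the value `∞` if there
are no real zeros. -/
def kappa {d : ℕ} (Ω : Set (EuclideanSpace ℝ (Fin d))) : ENNReal :=
  ⨅ ξ ∈ realNullVariety Ω, ENNReal.ofReal ‖ξ‖

/-- `Ω` is invariant under the mapping `x ↦ -x`. -/
def IsBalancedSet {d : ℕ} (Ω : Set (EuclideanSpace ℝ (Fin d))) : Prop :=
  (fun x => -x) '' Ω = Ω

/-- `Ω*`: the open ball centred at the origin with the same volume as `Ω`, its radius being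
`(vol Ω / vol B)^(1/d)` with `B` the unit ball. -/
def equivolBall {d : ℕ} (Ω : Set (EuclideanSpace ℝ (Fin d))) : Set (EuclideanSpace ℝ (Fin d)) :=
  Metric.ball 0
    ((volume Ω / volume (Metric.ball (0 : EuclideanSpace ℝ (Fin d)) 1)).toReal ^ ((d : ℝ)⁻¹))

/-- The ball `Ω*` indeed has the volume of `Ω`. -/
theorem volume_equivolBall {d : ℕ} (hd : d ≠ 0) (Ω : Set (EuclideanSpace ℝ (Fin d)))
    (hΩ : volume Ω ≠ ⊤) : volume (equivolBall Ω) = volume Ω := by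
  have hne : Nonempty (Fin d) := ⟨⟨0, Nat.pos_of_ne_zero hd⟩⟩
  have h0 : volume (Metric.ball (0 : EuclideanSpace ℝ (Fin d)) 1) ≠ 0 :=
    (Metric.measure_ball_pos volume _ one_pos).ne'
  have h1 : volume (Metric.ball (0 : EuclideanSpace ℝ (Fin d)) 1) ≠ ⊤ := measure_ball_lt_top.ne
  unfold equivolBall
  rw [Measure.addHaar_ball _ _ (Real.rpow_nonneg ENNReal.toReal_nonneg _),
    finrank_euclideanSpace_fin, Real.rpow_inv_natCast_pow ENNReal.toReal_nonneg hd,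
    ENNReal.ofReal_toReal (ENNReal.div_ne_top hΩ h0), ENNReal.div_mul_cancel h0 h1]

/-- The Bessel function of the first kind of integer order `n ≥ 0`,
`J_n(x) = ∑ₘ (-1)ᵐ / (m! (m + n)!) (x / 2)^(2m + n)`. -/
def besselJ (n : ℕ) (x : ℝ) : ℝ :=
  ∑' m : ℕ, (-1 : ℝ) ^ m / ((m.factorial : ℝ) * ((m + n).factorial : ℝ)) * (x / 2) ^ (2 * m + n)

/-- The series defining `besselJ` converges (absolutely) everywhere. -/
theorem summable_besselJ (n : ℕ) (x : ℝ) :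
    Summable fun m : ℕ =>
      (-1 : ℝ) ^ m / ((m.factorial : ℝ) * ((m + n).factorial : ℝ)) * (x / 2) ^ (2 * m + n) := by
  refine Summable.of_norm_bounded
    (g := fun m : ℕ => |x / 2| ^ n * ((|x / 2| ^ 2) ^ m / (m.factorial : ℝ)))
    ((Real.summable_pow_div_factorial _).mul_left _) fun m => ?_
  have h1 : (1 : ℝ) ≤ ((m + n).factorial : ℝ) := by exact_mod_cast Nat.succ_le_of_lt (Nat.factorial_pos _)
  have h2 : (0 : ℝ) < (m.factorial : ℝ) := by exact_mod_cast Nat.factorial_pos _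
  have h3 : (0 : ℝ) ≤ |x / 2| ^ (2 * m + n) := by positivity
  rw [norm_mul, norm_div, norm_pow, norm_neg, norm_one, one_pow, norm_pow, Real.norm_eq_abs,
    Real.norm_eq_abs, abs_of_pos (by positivity)]
  calc 1 / ((m.factorial : ℝ) * ((m + n).factorial : ℝ)) * |x / 2| ^ (2 * m + n)
      ≤ 1 / (m.factorial : ℝ) * |x / 2| ^ (2 * m + n) := by
        gcongr
        exact le_mul_of_one_le_right h2.le h1
    _ = _ := by rw [pow_add, pow_mul]; ring

/-- `j_{n,1}`: the first positive zero of the Bessel function `J_n`. -/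
def besselFirstZero (n : ℕ) : ℝ :=
  sInf {x : ℝ | 0 < x ∧ besselJ n x = 0}

end

/-! ### Polynomial inequalities for truncated Bessel series -/

section

open Set Filter Topology

/-! Let `R` be the radius of the disk `Ω*`. The disk's transform at `ξ` is a positive multiple of
`J_1(R|ξ|)/|ξ|`, so `κ(Ω*) ≥ j_{1,1}/R` (`le_kappa_ball`). It remains to prove `κ(Ω) ≤ r` with `r =
2 j_{0,1}/R`. As `Ω` is balanced, its transform is real, a cosine integral, and positive at the
origin. So any point where it is nonpositive bounds `κ(Ω)` by the norm of that point
(`kappa_le_of_cosInt_nonpos`). Let `h` be the largest norm on the closure of `Ω`.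

Long case, `h ≥ 2π/r`. Take the axis through a farthest point. The section lengths orthogonal to it
form a concave function on `(-h, h)`, and each half of this interval is one full period of
`cos(2πt/h)`. A concave function integrates to a nonpositive value against such a period
(`integral_cos_mul_concave_nonpos`), so `κ(Ω) ≤ 2π/h ≤ r`.

Short case, `h ≤ 2π/r`. The mean of the transform over the circle `|ξ| = r` is `∫_Ω J_0(r|x|) dx`.
In polar coordinates, with radial function `ρ(θ) ≤ h`, this is the integral of `ρ J_1(rρ)/r` over
`θ`. On `[0, 2π]` one has `t J_1(t) ≤ 0.078 (4 j_{0,1}² - t²)` (`mul_besselJ_one_add_sq_le`). Since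
`∫ ρ² dθ = 2|Ω| = 2πR²`, the resulting bound is exactly zero for this `r`, and the transform is
nonpositive somewhere on the circle. -/

theorem besselPoly_zero_pos {u : ℝ} (h₀ : 0 ≤ u) (h₁ : u < 144579/100000) :
    0 < (1) + (-1) * u ^ 1 + (1/4) * u ^ 2 + (-1/36) * u ^ 3 + (1/576) * u ^ 4 +
      (-1/14400) * u ^ 5 + (1/518400) * u ^ 6 + (-1/25401600) * u ^ 7 := by
  have ha : 0 ≤ u := h₀
  have hb : 0 < 144579/100000 - u := sub_pos.2 h₁
  -- Bernstein form on the interval: all coefficients in the products of powers of `u` and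
  -- `144579/100000 - u` are positive. The other polynomial bounds use the same certificate.
  calc 0 < (100000000000000000000000000000000000/1320494254609529582523807871658227659) * (144579/100000 - u) ^ 7 +
      (555421000000000000000000000000000000/1320494254609529582523807871658227659) * u ^ 1 * (144579/100000 - u) ^ 6 +
      (428261239367500000000000000000000000/440164751536509860841269290552742553) * u ^ 2 * (144579/100000 - u) ^ 5 +
      (1584208736484120725000000000000000000/1320494254609529582523807871658227659) * u ^ 3 * (144579/100000 - u) ^ 4 +
      (1098176339661838554500140625000000000/1320494254609529582523807871658227659) * u ^ 4 * (144579/100000 - u) ^ 3 +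
      (135251637171419548477210514143750000/440164751536509860841269290552742553) * u ^ 5 * (144579/100000 - u) ^ 2 +
      (499399370450707778050991095549905125/10563954036876236660190462973265821272) * u ^ 6 * (144579/100000 - u) ^ 1 +
      (87521874339967562527340253667835461/414106998245548477079466148552020193862400) * u ^ 7 := by positivity
    _ = _ := by ring

theorem besselPoly_one_pos {u : ℝ} (h₀ : 0 ≤ u) (h₁ : u < 367049/100000) :
    0 < (1) + (-1/2) * u ^ 1 + (1/12) * u ^ 2 + (-1/144) * u ^ 3 + (1/2880) * u ^ 4 +
      (-1/86400) * u ^ 5 + (1/3628800) * u ^ 6 + (-1/203212800) * u ^ 7 +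
      (1/14631321600) * u ^ 8 + (-1/1316818944000) * u ^ 9 := by
  have ha : 0 ≤ u := h₀
  have hb : 0 < 367049/100000 - u := sub_pos.2 h₁
  calc 0 < (1000000000000000000000000000000000000000000000/120925086530758591825938751762879803069499586013449) * (367049/100000 - u) ^ 9 +
      (7164755000000000000000000000000000000000000000/120925086530758591825938751762879803069499586013449) * u ^ 1 * (367049/100000 - u) ^ 8 +
      (67322244210025000000000000000000000000000000000/362775259592275775477816255288639409208498758040347) * u ^ 2 * (367049/100000 - u) ^ 7 +
      (361158201852611334437500000000000000000000000000/1088325778776827326433448765865918227625496274121041) * u ^ 3 * (367049/100000 - u) ^ 6 +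
      (403251558918800833140525031250000000000000000000/1088325778776827326433448765865918227625496274121041) * u ^ 4 * (367049/100000 - u) ^ 5 +
      (863566081595200974405678521554718750000000000000/3264977336330481979300346297597754682876488822363123) * u ^ 5 * (367049/100000 - u) ^ 4 +
      (8081440468918151599014083621951778937656250000000/68564524062940121565307272249552848340406265269625583) * u ^ 6 * (367049/100000 - u) ^ 3 +
      (28774036755380875157741554781707397481780527734375/959903336881161701914301811493739876765687713774758162) * u ^ 7 * (367049/100000 - u) ^ 2 +
      (7366181253359373310602502631902787508259735204200125/2211617288174196561210551373681576676068144492537042805248) * u ^ 8 * (367049/100000 - u) ^ 1 +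
      (7765376873438709192761558080612166728171486183399/3249723362215145967493055079695377972998089866585042489344000) * u ^ 9 := by positivity
    _ = _ := by ring

/-- The polynomial is `1.8 - 0.312 u - 2 u S(u)`, with `S` the nine-term partial sum of
`besselSeries 1`. The range is cut at 2 and 4, giving nonnegative Bernstein coefficients on each
piece. -/
theorem besselPoly_parabola_low {u : ℝ} (h₀ : 0 ≤ u) (h₁ : u ≤ 2) :
    0 ≤ (9/5) + (-289/125) * u ^ 1 + (1) * u ^ 2 + (-1/6) * u ^ 3 + (1/72) * u ^ 4 +
      (-1/1440) * u ^ 5 + (1/43200) * u ^ 6 + (-1/1814400) * u ^ 7 + (1/101606400) * u ^ 8 +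
      (-1/7315660800) * u ^ 9 := by
  have ha : 0 ≤ u := h₀
  have hb : 0 ≤ 2 - u := sub_nonneg.2 h₁
  calc 0 ≤ (9/2560) * (2 - u) ^ 9 +
      (1447/64000) * u ^ 1 * (2 - u) ^ 8 +
      (497/8000) * u ^ 2 * (2 - u) ^ 7 +
      (4537/48000) * u ^ 3 * (2 - u) ^ 6 +
      (12397/144000) * u ^ 4 * (2 - u) ^ 5 +
      (5447/115200) * u ^ 5 * (2 - u) ^ 4 +
      (26069/1728000) * u ^ 6 * (2 - u) ^ 3 +
      (25183/9072000) * u ^ 7 * (2 - u) ^ 2 +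
      (465421/1016064000) * u ^ 8 * (2 - u) ^ 1 +
      (449881/5225472000) * u ^ 9 := by positivity
    _ = _ := by ring

theorem besselPoly_parabola_mid {u : ℝ} (h₀ : 2 ≤ u) (h₁ : u ≤ 4) :
    0 ≤ (9/5) + (-289/125) * u ^ 1 + (1) * u ^ 2 + (-1/6) * u ^ 3 + (1/72) * u ^ 4 +
      (-1/1440) * u ^ 5 + (1/43200) * u ^ 6 + (-1/1814400) * u ^ 7 + (1/101606400) * u ^ 8 +
      (-1/7315660800) * u ^ 9 := by
  have ha : 0 ≤ u - 2 := sub_nonneg.2 h₀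
  have hb : 0 ≤ 4 - u := sub_nonneg.2 h₁
  calc 0 ≤ (449881/5225472000) * (4 - u) ^ 9 +
      (88733/81285120) * (u - 2) ^ 1 * (4 - u) ^ 8 +
      (1992607/254016000) * (u - 2) ^ 2 * (4 - u) ^ 7 +
      (3301679/108864000) * (u - 2) ^ 3 * (4 - u) ^ 6 +
      (2459503/36288000) * (u - 2) ^ 4 * (4 - u) ^ 5 +
      (1685927/18144000) * (u - 2) ^ 5 * (4 - u) ^ 4 +
      (434477/5443200) * (u - 2) ^ 6 * (4 - u) ^ 3 +
      (47693/1134000) * (u - 2) ^ 7 * (4 - u) ^ 2 +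
      (3165751/254016000) * (u - 2) ^ 8 * (4 - u) ^ 1 +
      (3644309/2286144000) * (u - 2) ^ 9 := by positivity
    _ = _ := by ring

theorem besselPoly_parabola_high {u : ℝ} (h₀ : 4 ≤ u) (h₁ : u ≤ 987/100) :
    0 ≤ (9/5) + (-289/125) * u ^ 1 + (1) * u ^ 2 + (-1/6) * u ^ 3 + (1/72) * u ^ 4 +
      (-1/1440) * u ^ 5 + (1/43200) * u ^ 6 + (-1/1814400) * u ^ 7 + (1/101606400) * u ^ 8 +
      (-1/7315660800) * u ^ 9 := by
  have ha : 0 ≤ u - 4 := sub_nonneg.2 h₀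
  have hb : 0 ≤ 987/100 - u := sub_nonneg.2 h₁
  calc 0 ≤ (29154472000000000000000/295574197805733199925941318467) * (987/100 - u) ^ 9 +
      (13463671280000000000000/10947192511323451849108937721) * (u - 4) ^ 1 * (987/100 - u) ^ 8 +
      (28856230324000000000000/4691653933424336506760973309) * (u - 4) ^ 2 * (987/100 - u) ^ 7 +
      (1203522720260000000000/74470697355941849313666243) * (u - 4) ^ 3 * (987/100 - u) ^ 6 +
      (617913249664600000000/24823565785313949771222081) * (u - 4) ^ 4 * (987/100 - u) ^ 5 +
      (1742972500150632875000/74470697355941849313666243) * (u - 4) ^ 5 * (987/100 - u) ^ 4 +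
      (329964474244950460625/24823565785313949771222081) * (u - 4) ^ 6 * (987/100 - u) ^ 3 +
      (69865680528149083575/16549043856875966514148054) * (u - 4) ^ 7 * (987/100 - u) ^ 2 +
      (2495143304902993559009/4236555227360247427621901824) * (u - 4) ^ 8 * (987/100 - u) ^ 1 +
      (8726701541901024273213/1694622090944098971048760729600) * (u - 4) ^ 9 := by positivity
    _ = _ := by ring

/-! ### Bessel functions: alternating series bounds and first zeros -/

/-- The even entire function underlying `besselJ`: `J_n(x) = (x/2)^n * besselSeries n ((x/2)^2)`. -/
noncomputable def besselSeries (n : ℕ) (u : ℝ) : ℝ :=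
  ∑' m : ℕ, (-1 : ℝ) ^ m * (u ^ m / ((m.factorial : ℝ) * ((m + n).factorial : ℝ)))

theorem summable_pow_div_factorial_mul_factorial (n : ℕ) (u : ℝ) :
    Summable fun m : ℕ => u ^ m / ((m.factorial : ℝ) * ((m + n).factorial : ℝ)) := by
  refine Summable.of_norm_bounded (g := fun m : ℕ => |u| ^ m / (m.factorial : ℝ))
    (Real.summable_pow_div_factorial _) fun m => ?_
  have h1 : (1 : ℝ) ≤ ((m + n).factorial : ℝ) := by
    exact_mod_cast Nat.succ_le_of_lt (Nat.factorial_pos _)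
  have h2 : (0 : ℝ) < (m.factorial : ℝ) := by exact_mod_cast Nat.factorial_pos _
  rw [norm_div, norm_pow, Real.norm_eq_abs,
    Real.norm_of_nonneg (r := (m.factorial : ℝ) * _) (by positivity)]
  gcongr
  exact le_mul_of_one_le_right h2.le h1

theorem summable_besselSeries (n : ℕ) (u : ℝ) :
    Summable fun m : ℕ =>
      (-1 : ℝ) ^ m * (u ^ m / ((m.factorial : ℝ) * ((m + n).factorial : ℝ))) := by
  refine (summable_pow_div_factorial_mul_factorial n (-u)).congr fun m => ?_
  rw [neg_pow, mul_div_assoc]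

theorem besselJ_eq_besselSeries (n : ℕ) (x : ℝ) :
    besselJ n x = (x / 2) ^ n * besselSeries n ((x / 2) ^ 2) := by
  unfold besselJ besselSeries
  rw [← tsum_mul_left]
  refine tsum_congr fun m => ?_
  rw [← pow_mul, pow_add]
  ring

/-- The ratio of consecutive terms is `u / ((m + 5)(m + 5 + n)) ≤ 16/25`. -/
theorem besselSeries_term_succ_le {n : ℕ} {u : ℝ} (h0 : 0 ≤ u) (h1 : u ≤ 16) (m : ℕ) :
    u ^ (m + 1 + 4) / (((m + 1 + 4).factorial : ℝ) * ((m + 1 + 4 + n).factorial : ℝ)) ≤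
      u ^ (m + 4) / (((m + 4).factorial : ℝ) * ((m + 4 + n).factorial : ℝ)) := by
  have e1 : ((m + 1 + 4).factorial : ℝ) = (m + 5) * ((m + 4).factorial : ℝ) := by
    rw [show m + 1 + 4 = (m + 4) + 1 by ring, Nat.factorial_succ]; push_cast; ring
  have e2 : ((m + 1 + 4 + n).factorial : ℝ) = (m + 5 + n) * ((m + 4 + n).factorial : ℝ) := by
    rw [show m + 1 + 4 + n = (m + 4 + n) + 1 by ring, Nat.factorial_succ]; push_cast; ring
  have p1 : (0 : ℝ) < ((m + 4).factorial : ℝ) := by exact_mod_cast Nat.factorial_pos _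
  have p2 : (0 : ℝ) < ((m + 4 + n).factorial : ℝ) := by exact_mod_cast Nat.factorial_pos _
  rw [e1, e2, show m + 1 + 4 = (m + 4) + 1 by ring, pow_succ, div_le_div_iff₀ (by positivity)
    (by positivity)]
  have h2 : u ≤ (m + 5) * (m + 5 + n) := by
    have hm : (0 : ℝ) ≤ m := by positivity
    have hn : (0 : ℝ) ≤ n := by positivity
    nlinarith [mul_nonneg hm hm, mul_nonneg hm hn]
  calc u ^ (m + 4) * u * (((m + 4).factorial : ℝ) * ((m + 4 + n).factorial : ℝ))
      = (u ^ (m + 4) * (((m + 4).factorial : ℝ) * ((m + 4 + n).factorial : ℝ))) * u := by ring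
    _ ≤ (u ^ (m + 4) * (((m + 4).factorial : ℝ) * ((m + 4 + n).factorial : ℝ))) *
        ((m + 5) * (m + 5 + n)) := by gcongr
    _ = _ := by ring

/-- Alternating series bounds for `besselSeries`, valid from the fourth term on. -/
theorem besselSeries_bounds {n : ℕ} {u : ℝ} (h0 : 0 ≤ u) (h1 : u ≤ 16) (k : ℕ) :
    ∑ m ∈ Finset.range (2 * k + 4),
        (-1 : ℝ) ^ m * (u ^ m / ((m.factorial : ℝ) * ((m + n).factorial : ℝ))) ≤
      besselSeries n u ∧
    besselSeries n u ≤ ∑ m ∈ Finset.range (2 * k + 1 + 4),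
        (-1 : ℝ) ^ m * (u ^ m / ((m.factorial : ℝ) * ((m + n).factorial : ℝ))) := by
  set a : ℕ → ℝ := fun m => u ^ m / ((m.factorial : ℝ) * ((m + n).factorial : ℝ)) with ha
  have hanti : Antitone fun m => a (m + 4) :=
    antitone_nat_of_succ_le fun m => besselSeries_term_succ_le h0 h1 m
  have hs := summable_besselSeries n u
  have ht := ((summable_nat_add_iff 4).2 hs).hasSum.tendsto_sum_nat
  have e : ∀ m : ℕ, (-1 : ℝ) ^ (m + 4) * (u ^ (m + 4) /
      (((m + 4).factorial : ℝ) * ((m + 4 + n).factorial : ℝ))) = (-1) ^ m * a (m + 4) := by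
    intro m
    rw [pow_add]
    norm_num [ha]
  have hsum : besselSeries n u = ∑ m ∈ Finset.range 4, (-1 : ℝ) ^ m * a m +
      ∑' m, (-1 : ℝ) ^ m * a (m + 4) := by
    rw [besselSeries, ← hs.sum_add_tsum_nat_add 4]
    congr 1
    exact tsum_congr e
  have hfin : ∀ N, ∑ m ∈ Finset.range (N + 4), (-1 : ℝ) ^ m * a m =
      ∑ m ∈ Finset.range 4, (-1 : ℝ) ^ m * a m +
        ∑ m ∈ Finset.range N, (-1 : ℝ) ^ m * a (m + 4) := by
    intro N
    rw [add_comm N 4, Finset.sum_range_add]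
    congr 1
    refine Finset.sum_congr rfl fun m _ => ?_
    rw [add_comm 4 m, ← e m]
  simp_rw [e] at ht
  rw [hfin (2 * k), hfin (2 * k + 1), hsum]
  exact ⟨add_le_add_right (hanti.alternating_series_le_tendsto ht k) _,
    add_le_add_right (hanti.tendsto_le_alternating_series ht k) _⟩

theorem continuous_besselSeries (n : ℕ) : Continuous (besselSeries n) := by
  refine continuous_iff_continuousAt.2 fun x => ?_
  have hc : ContinuousOn (besselSeries n) (Ioo (-(|x| + 1)) (|x| + 1)) := by
    refine continuousOn_tsum (u := fun m : ℕ =>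
      (|x| + 1) ^ m / ((m.factorial : ℝ) * ((m + n).factorial : ℝ)))
      (fun m => by fun_prop) (summable_pow_div_factorial_mul_factorial n _) fun m u hu => ?_
    have h2 : (0 : ℝ) < (m.factorial : ℝ) := by exact_mod_cast Nat.factorial_pos _
    have h3 : (0 : ℝ) < ((m + n).factorial : ℝ) := by exact_mod_cast Nat.factorial_pos _
    rw [norm_mul, norm_pow, norm_neg, norm_one, one_pow, one_mul, norm_div, norm_pow,
      Real.norm_eq_abs, Real.norm_of_nonneg (r := (m.factorial : ℝ) * _) (by positivity)]
    have := (abs_lt.2 ⟨hu.1, hu.2⟩).le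
    gcongr
  exact hc.continuousAt (Ioo_mem_nhds (by linarith [neg_abs_le x]) (by linarith [le_abs_self x]))

theorem continuous_besselJ (n : ℕ) : Continuous (besselJ n) := by
  have : besselJ n = fun x => (x / 2) ^ n * besselSeries n ((x / 2) ^ 2) :=
    funext (besselJ_eq_besselSeries n)
  rw [this]
  have := continuous_besselSeries n
  fun_prop

theorem besselSeries_zero_pos {u : ℝ} (h₀ : 0 ≤ u) (h₁ : u < 1.44579) :
    0 < besselSeries 0 u := by
  have h := (besselSeries_bounds (n := 0) h₀ (by linarith) 2).1
  refine lt_of_lt_of_le ?_ h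
  refine (besselPoly_zero_pos h₀ (by linarith)).trans_eq ?_
  norm_num [Finset.sum_range_succ, Nat.factorial]
  ring

theorem besselSeries_one_pos {u : ℝ} (h₀ : 0 ≤ u) (h₁ : u < 3.67049) :
    0 < besselSeries 1 u := by
  have h := (besselSeries_bounds (n := 1) h₀ (by linarith) 3).1
  refine lt_of_lt_of_le ?_ h
  refine (besselPoly_one_pos h₀ (by linarith)).trans_eq ?_
  norm_num [Finset.sum_range_succ, Nat.factorial]
  ring

/-- With `u = (t/2)²` the left side is `t J_1(t) + 0.078 t²`. The number 1.8 lies just below `0.312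
j_{0,1}²`, and 9.87 just above `π²`. -/
theorem besselSeries_one_parabola {u : ℝ} (h₀ : 0 ≤ u) (h₁ : u ≤ 9.87) :
    2 * u * besselSeries 1 u + 0.312 * u ≤ 1.8 := by
  have h := (besselSeries_bounds (n := 1) h₀ (by linarith) 2).2
  have h2 : 2 * u * besselSeries 1 u ≤ 2 * u * _ :=
    mul_le_mul_of_nonneg_left h (by linarith)
  norm_num [Finset.sum_range_succ, Nat.factorial] at h2
  rcases le_total u 2 with h3 | h3
  · have := besselPoly_parabola_low h₀ h3
    linarith
  rcases le_total u 4 with h4 | h4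
  · have := besselPoly_parabola_mid h3 h4
    linarith
  · have := besselPoly_parabola_high h4 (by linarith)
    linarith

theorem exists_besselJ_zero_eq_zero : ∃ x ∈ Ioo (0 : ℝ) 2.40483, besselJ 0 x = 0 := by
  have h := (besselSeries_bounds (n := 0) (u := (2.40483 / 2) ^ 2)
    (by norm_num) (by norm_num) 2).2
  have h0 : besselJ 0 2.40483 < 0 := by
    rw [besselJ_eq_besselSeries, pow_zero, one_mul]
    refine h.trans_lt ?_
    norm_num [Finset.sum_range_succ, Nat.factorial]
  have h1 : 0 < besselJ 0 0.1 := by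
    rw [besselJ_eq_besselSeries]
    have := besselSeries_zero_pos (u := (0.1 / 2) ^ 2) (by norm_num) (by norm_num)
    positivity
  obtain ⟨x, hx, hx0⟩ := intermediate_value_Ioo' (by norm_num : (0.1 : ℝ) ≤ 2.40483)
    (continuous_besselJ 0).continuousOn ⟨h0, h1⟩
  exact ⟨x, ⟨by linarith [hx.1], hx.2⟩, hx0⟩

theorem exists_besselJ_one_eq_zero : ∃ x ∈ Ioo (0 : ℝ) 3.83171, besselJ 1 x = 0 := by
  have h := (besselSeries_bounds (n := 1) (u := (3.83171 / 2) ^ 2)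
    (by norm_num) (by norm_num) 2).2
  have h0 : besselJ 1 3.83171 < 0 := by
    rw [besselJ_eq_besselSeries]
    refine mul_neg_of_pos_of_neg (by norm_num) (h.trans_lt ?_)
    norm_num [Finset.sum_range_succ, Nat.factorial]
  have h1 : 0 < besselJ 1 0.1 := by
    rw [besselJ_eq_besselSeries]
    have := besselSeries_one_pos (u := (0.1 / 2) ^ 2) (by norm_num) (by norm_num)
    positivity
  obtain ⟨x, hx, hx0⟩ := intermediate_value_Ioo' (by norm_num : (0.1 : ℝ) ≤ 3.83171)
    (continuous_besselJ 1).continuousOn ⟨h0, h1⟩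
  exact ⟨x, ⟨by linarith [hx.1], hx.2⟩, hx0⟩

theorem bddBelow_besselJ_zeros (n : ℕ) : BddBelow {x : ℝ | 0 < x ∧ besselJ n x = 0} :=
  ⟨0, fun _ hx => hx.1.le⟩

theorem besselJ_ne_zero_of_lt_besselFirstZero {n : ℕ} {x : ℝ} (h0 : 0 < x)
    (h1 : x < besselFirstZero n) : besselJ n x ≠ 0 := fun h =>
  notMem_of_lt_csInf h1 (bddBelow_besselJ_zeros n) ⟨h0, h⟩

/-- A sign change gives the upper bound and also makes the set of zeros nonempty, so that `sInf` is
not the default 0. Positivity of the partial sum gives the lower bound. -/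
theorem besselFirstZero_zero_mem : besselFirstZero 0 ∈ Icc (2.40482 : ℝ) 2.40483 := by
  obtain ⟨x, hx, hx0⟩ := exists_besselJ_zero_eq_zero
  refine ⟨le_csInf ⟨x, hx.1, hx0⟩ fun y hy => ?_,
    (csInf_le (bddBelow_besselJ_zeros 0) ⟨hx.1, hx0⟩).trans hx.2.le⟩
  by_contra! hlt
  have hy0 := hy.1
  refine (?_ : 0 < besselJ 0 y).ne' hy.2
  rw [besselJ_eq_besselSeries]
  have := besselSeries_zero_pos (u := (y / 2) ^ 2) (by positivity) (by nlinarith)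
  positivity

theorem besselFirstZero_one_mem : besselFirstZero 1 ∈ Icc (3.8317 : ℝ) 3.83171 := by
  obtain ⟨x, hx, hx0⟩ := exists_besselJ_one_eq_zero
  refine ⟨le_csInf ⟨x, hx.1, hx0⟩ fun y hy => ?_,
    (csInf_le (bddBelow_besselJ_zeros 1) ⟨hx.1, hx0⟩).trans hx.2.le⟩
  by_contra! hlt
  have hy0 := hy.1
  refine (?_ : 0 < besselJ 1 y).ne' hy.2
  rw [besselJ_eq_besselSeries]
  have := besselSeries_one_pos (u := (y / 2) ^ 2) (by positivity) (by nlinarith)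
  positivity

theorem abs_besselFirstZero_ratio_sub_le :
    |2 * besselFirstZero 0 / besselFirstZero 1 - 1.2552| ≤ 0.00005 := by
  obtain ⟨h1, h2⟩ := besselFirstZero_zero_mem
  obtain ⟨h3, h4⟩ := besselFirstZero_one_mem
  have hp : 0 < besselFirstZero 1 := by linarith
  rw [abs_le, neg_le_sub_iff_le_add, sub_le_iff_le_add, ← sub_le_iff_le_add, le_div_iff₀ hp,
    div_le_iff₀ hp]
  constructor <;> nlinarith

/-- The parabola `0.078 (4 j_{0,1}² - t²)` majorises `t J_1(t)`. Its zero at `2 j_{0,1}` is what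
produces the constant of the theorem; the factor 0.078 cancels in the end. It tends to `-∞` too fast
for a bound on all `t ≥ 0`, hence the cutoff at `2π` and the separate treatment of long bodies. -/
theorem mul_besselJ_one_add_sq_le {t : ℝ} (h0 : 0 ≤ t) (h1 : t ≤ 2 * Real.pi) :
    t * besselJ 1 t + 0.078 * t ^ 2 ≤ 0.312 * besselFirstZero 0 ^ 2 := by
  have hu : (t / 2) ^ 2 ≤ 9.87 := by
    have := Real.pi_lt_d4
    nlinarith [Real.pi_pos]
  have h := besselSeries_one_parabola (u := (t / 2) ^ 2) (by positivity) hu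
  have h2 : (2.40482 : ℝ) ^ 2 ≤ besselFirstZero 0 ^ 2 :=
    pow_le_pow_left₀ (by norm_num) besselFirstZero_zero_mem.1 2
  rw [besselJ_eq_besselSeries]
  calc _ = 2 * (t / 2) ^ 2 * besselSeries 1 ((t / 2) ^ 2) + 0.312 * (t / 2) ^ 2 := by ring
    _ ≤ 1.8 := h
    _ ≤ _ := by linarith

/-! ### Integral formulas for `J_0` and `J_1` -/

open intervalIntegral in
theorem integral_sin_pow_even_symm (m : ℕ) :
    ∫ θ in (-Real.pi)..Real.pi, Real.sin θ ^ (2 * m) =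
      2 * Real.pi * (((2 * m).factorial : ℝ) / (4 ^ m * (m.factorial : ℝ) ^ 2)) := by
  have hc : Continuous fun θ : ℝ => Real.sin θ ^ (2 * m) := by fun_prop
  have h1 : ∫ θ in (-Real.pi)..0, Real.sin θ ^ (2 * m) =
      ∫ θ in (0 : ℝ)..Real.pi, Real.sin θ ^ (2 * m) := by
    have := integral_comp_neg (a := 0) (b := Real.pi) fun θ : ℝ => Real.sin θ ^ (2 * m)
    simp only [Real.sin_neg, neg_zero, (even_two_mul m).neg_pow] at this
    exact this.symm
  have h2 : ∏ i ∈ Finset.range m, (2 * (i : ℝ) + 1) / (2 * i + 2) =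
      ((2 * m).factorial : ℝ) / (4 ^ m * (m.factorial : ℝ) ^ 2) := by
    induction m with
    | zero => simp
    | succ k ih =>
      have hk : (0 : ℝ) < (k.factorial : ℝ) := by exact_mod_cast Nat.factorial_pos _
      rw [Finset.prod_range_succ, ih (by fun_prop) (by
        have := integral_comp_neg (a := 0) (b := Real.pi) fun θ : ℝ => Real.sin θ ^ (2 * k)
        simp only [Real.sin_neg, neg_zero, (even_two_mul k).neg_pow] at this
        exact this.symm), show 2 * (k + 1) = 2 * k + 1 + 1 by ring, Nat.factorial_succ,
        Nat.factorial_succ, Nat.factorial_succ]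
      push_cast
      field_simp
      ring
  rw [← integral_add_adjacent_intervals (hc.intervalIntegrable _ 0) (hc.intervalIntegrable _ _),
    h1, integral_sin_pow_even, h2]
  ring

theorem integral_cos_mul_sin (t : ℝ) :
    ∫ θ in (-Real.pi)..Real.pi, Real.cos (t * Real.sin θ) = 2 * Real.pi * besselJ 0 t := by
  have hs : Summable fun m : ℕ => |t| ^ (2 * m) / ((2 * m).factorial : ℝ) :=
    (Real.summable_pow_div_factorial |t|).comp_injective
      (mul_right_injective₀ (two_ne_zero (α := ℕ)))
  have h := intervalIntegral.hasSum_integral_of_dominated_convergence (μ := volume)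
    (a := -Real.pi) (b := Real.pi) (ι := ℕ)
    (F := fun m θ => (-1) ^ m * (t * Real.sin θ) ^ (2 * m) / ((2 * m).factorial : ℝ))
    (f := fun θ => Real.cos (t * Real.sin θ))
    (fun m _ => |t| ^ (2 * m) / ((2 * m).factorial : ℝ))
    (fun m => (by fun_prop : Continuous fun θ : ℝ =>
      (-1) ^ m * (t * Real.sin θ) ^ (2 * m) / ((2 * m).factorial : ℝ)).aestronglyMeasurable)
    (fun m => Eventually.of_forall fun θ _ => by
      have h2 : (0 : ℝ) < ((2 * m).factorial : ℝ) := by exact_mod_cast Nat.factorial_pos _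
      rw [norm_div, norm_mul, norm_pow, norm_neg, norm_one, one_pow, one_mul, norm_pow, norm_mul,
        Real.norm_eq_abs, Real.norm_eq_abs, Real.norm_of_nonneg h2.le]
      gcongr
      exact mul_le_of_le_one_right (abs_nonneg _) (Real.abs_sin_le_one θ))
    (Eventually.of_forall fun _ _ => hs) (by simp)
    (Eventually.of_forall fun θ _ => Real.hasSum_cos _)
  rw [← h.tsum_eq, besselJ, ← tsum_mul_left]
  refine tsum_congr fun m => ?_
  have h2 : (0 : ℝ) < ((2 * m).factorial : ℝ) := by exact_mod_cast Nat.factorial_pos _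
  have h3 : (0 : ℝ) < (m.factorial : ℝ) := by exact_mod_cast Nat.factorial_pos _
  have e : ∀ θ : ℝ, (-1) ^ m * (t * Real.sin θ) ^ (2 * m) / ((2 * m).factorial : ℝ) =
      ((-1) ^ m * t ^ (2 * m) / ((2 * m).factorial : ℝ)) * Real.sin θ ^ (2 * m) := by
    intro θ; rw [mul_pow]; ring
  simp_rw [e]
  rw [intervalIntegral.integral_const_mul, integral_sin_pow_even_symm, add_zero, add_zero,
    div_pow, show (2 : ℝ) ^ (2 * m) = 4 ^ m by rw [pow_mul]; norm_num]
  field_simp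

/-- Bessel's integral: the mean of a plane wave over a circle. -/
theorem integral_cos_mul_cos_add_mul_sin (a b : ℝ) :
    ∫ θ in (-Real.pi)..Real.pi, Real.cos (a * Real.cos θ + b * Real.sin θ) =
      2 * Real.pi * besselJ 0 (Real.sqrt (a ^ 2 + b ^ 2)) := by
  -- For `z = b + ia`, `a cos θ + b sin θ = |z| sin(θ + arg z)`; periodicity removes the phase.
  set z : ℂ := ⟨b, a⟩
  have hz : ‖z‖ = Real.sqrt (a ^ 2 + b ^ 2) := by
    rw [Complex.norm_def, Complex.normSq_mk]; ring_nf
  have hb : b = ‖z‖ * Real.cos z.arg := (Complex.norm_mul_cos_arg z).symm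
  have ha : a = ‖z‖ * Real.sin z.arg := (Complex.norm_mul_sin_arg z).symm
  have e : ∀ θ : ℝ, Real.cos (a * Real.cos θ + b * Real.sin θ) =
      Real.cos (‖z‖ * Real.sin (θ + z.arg)) := by
    intro θ
    rw [Real.sin_add]
    conv_lhs => rw [ha, hb]
    ring_nf
  have hper : Function.Periodic (fun θ => Real.cos (‖z‖ * Real.sin θ)) (2 * Real.pi) := by
    intro θ; simp only [Real.sin_add_two_pi]
  simp_rw [e]
  rw [intervalIntegral.integral_comp_add_right fun θ => Real.cos (‖z‖ * Real.sin θ)]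
  have := hper.intervalIntegral_add_eq (-Real.pi + z.arg) (-Real.pi)
  rw [show -Real.pi + z.arg + 2 * Real.pi = Real.pi + z.arg by ring,
    show -Real.pi + 2 * Real.pi = Real.pi by ring] at this
  rw [this, integral_cos_mul_sin, hz]

/-- This is `(x J_1(x))' = x J_0(x)` in integrated form, obtained by integrating the series
termwise. -/
theorem mul_integral_mul_besselJ_zero (r : ℝ) {ρ : ℝ} (hρ : 0 ≤ ρ) :
    r * ∫ s in (0 : ℝ)..ρ, s * besselJ 0 (r * s) = ρ * besselJ 1 (r * ρ) := by
  have h := intervalIntegral.hasSum_integral_of_dominated_convergence (μ := volume)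
    (a := 0) (b := ρ) (ι := ℕ)
    (F := fun m s => s * ((-1 : ℝ) ^ m / ((m.factorial : ℝ) * ((m + 0).factorial : ℝ)) *
      (r * s / 2) ^ (2 * m + 0)))
    (f := fun s => s * besselJ 0 (r * s))
    (fun m _ => ρ * (((|r| * ρ / 2) ^ 2) ^ m / (m.factorial * (m + 0).factorial)))
    (fun m => (by fun_prop : Continuous fun s : ℝ =>
      s * ((-1 : ℝ) ^ m / ((m.factorial : ℝ) * ((m + 0).factorial : ℝ)) *
      (r * s / 2) ^ (2 * m + 0))).aestronglyMeasurable)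
    (fun m => Eventually.of_forall fun s hs => by
      have h3 : (0 : ℝ) < (m.factorial : ℝ) := by exact_mod_cast Nat.factorial_pos _
      rw [uIoc_of_le hρ] at hs
      have hs0 := hs.1.le
      have hs1 := hs.2
      rw [norm_mul, norm_mul, norm_div, norm_pow, norm_neg, norm_one, one_pow, norm_pow,
        norm_div, norm_mul r, Real.norm_of_nonneg hs0, Real.norm_eq_abs r, ← pow_mul, add_zero,
        add_zero, Real.norm_of_nonneg (by positivity : (0 : ℝ) ≤ m.factorial * m.factorial),
        Real.norm_two, one_div_mul_eq_div]
      gcongr)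
    (Eventually.of_forall fun _ _ =>
      (summable_pow_div_factorial_mul_factorial 0 _).mul_left ρ) (by simp)
    (Eventually.of_forall fun s _ => (summable_besselJ 0 (r * s)).hasSum.mul_left s)
  rw [← h.tsum_eq, besselJ, ← tsum_mul_left, ← tsum_mul_left]
  refine tsum_congr fun m => ?_
  have h3 : (0 : ℝ) < (m.factorial : ℝ) := by exact_mod_cast Nat.factorial_pos _
  have e : ∀ s : ℝ, s * ((-1 : ℝ) ^ m / ((m.factorial : ℝ) * ((m + 0).factorial : ℝ)) *
      (r * s / 2) ^ (2 * m + 0)) =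
      ((-1 : ℝ) ^ m / ((m.factorial : ℝ) * (m.factorial : ℝ)) * (r / 2) ^ (2 * m)) *
        s ^ (2 * m + 1) := by
    intro s; rw [add_zero, add_zero, mul_div_right_comm, mul_pow]; ring
  simp_rw [e]
  rw [intervalIntegral.integral_const_mul, integral_pow, Nat.factorial_succ, mul_div_right_comm,
    mul_pow, pow_succ (r / 2)]
  push_cast
  field_simp
  ring

/-! ### Polar coordinates -/

/-- The unit vector of `ℝ²` with polar angle `θ`. -/
noncomputable def unitVec (θ : ℝ) : EuclideanSpace ℝ (Fin 2) := !₂[Real.cos θ, Real.sin θ]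

theorem continuous_unitVec : Continuous unitVec := by
  unfold unitVec
  refine (PiLp.continuous_toLp 2 _).comp (continuous_pi fun i => ?_)
  fin_cases i
  · exact Real.continuous_cos
  · exact Real.continuous_sin

theorem norm_unitVec (θ : ℝ) : ‖unitVec θ‖ = 1 := by
  simp [unitVec, EuclideanSpace.norm_eq, Fin.sum_univ_two]

theorem norm_smul_unitVec {s : ℝ} (hs : 0 ≤ s) (θ : ℝ) : ‖s • unitVec θ‖ = s := by
  rw [norm_smul, norm_unitVec, mul_one, Real.norm_of_nonneg hs]

theorem integral_euclideanSpace_fin_two (f : EuclideanSpace ℝ (Fin 2) → ℝ) :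
    ∫ x, f x = ∫ p : ℝ × ℝ, f !₂[p.1, p.2] := by
  rw [← (PiLp.volume_preserving_toLp (Fin 2)).integral_comp
    (MeasurableEquiv.toLp 2 (Fin 2 → ℝ)).measurableEmbedding f,
    ← (volume_preserving_finTwoArrow ℝ).symm.integral_comp
    (MeasurableEquiv.finTwoArrow (α := ℝ)).symm.measurableEmbedding]
  rfl

theorem integral_polar_euclideanSpace (f : EuclideanSpace ℝ (Fin 2) → ℝ) :
    ∫ x, f x = ∫ p in Ioi (0 : ℝ) ×ˢ Ioo (-Real.pi) Real.pi, p.1 * f (p.1 • unitVec p.2) := by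
  rw [integral_euclideanSpace_fin_two, ← integral_comp_polarCoord_symm]
  refine integral_congr_ae (Eventually.of_forall fun p => ?_)
  simp only [polarCoord_symm_apply, smul_eq_mul, unitVec]
  congr 2
  ext i
  fin_cases i <;> simp

theorem setIntegral_radial {Ω : Set (EuclideanSpace ℝ (Fin 2))} (hm : MeasurableSet Ω)
    (hb : Bornology.IsBounded Ω) {g : ℝ → ℝ} (hg : Continuous g) :
    IntegrableOn (fun θ => ∫ s in {s : ℝ | 0 < s ∧ s • unitVec θ ∈ Ω}, s * g s)
      (Ioo (-Real.pi) Real.pi) ∧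
    ∫ x in Ω, g ‖x‖ = ∫ θ in Ioo (-Real.pi) Real.pi,
      ∫ s in {s : ℝ | 0 < s ∧ s • unitVec θ ∈ Ω}, s * g s := by
  obtain ⟨W, hW⟩ := hb.exists_norm_le
  obtain ⟨M, hM⟩ := (isCompact_Icc (a := (0 : ℝ)) (b := W)).exists_bound_of_continuousOn
    (f := fun s => s * g s) (by fun_prop)
  have hmeas : Measurable fun p : ℝ × ℝ => p.1 • unitVec p.2 :=
    (continuous_fst.smul (continuous_unitVec.comp continuous_snd)).measurable
  set F : ℝ × ℝ → ℝ := ({p : ℝ × ℝ | p.1 • unitVec p.2 ∈ Ω}).indicator fun p => p.1 * g p.1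
    with hF
  have hFm : Measurable F := Measurable.indicator (by fun_prop) (hmeas hm)
  have hint : IntegrableOn F (Ioi (0 : ℝ) ×ˢ Ioo (-Real.pi) Real.pi) := by
    -- The integrand vanishes for radii above `W`, which leaves a bounded function on a set of
    -- finite measure.
    refine IntegrableOn.of_forall_sdiff_eq_zero (s := Ioc 0 W ×ˢ Ioo (-Real.pi) Real.pi) ?_
      (measurableSet_Ioi.prod measurableSet_Ioo) ?_
    · refine Measure.integrableOn_of_bounded (M := |M|) ?_ hFm.aestronglyMeasurable ?_
      · rw [Measure.volume_eq_prod, Measure.prod_prod]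
        exact ENNReal.mul_ne_top (by simp) (by simp)
      · refine (ae_restrict_iff' (measurableSet_Ioc.prod measurableSet_Ioo)).2
          (Eventually.of_forall fun p hp => ?_)
        exact (norm_indicator_le_norm_self _ p).trans
          ((hM p.1 ⟨hp.1.1.le, hp.1.2⟩).trans (le_abs_self M))
    · rintro p ⟨⟨hp1, hp2⟩, hp3⟩
      refine indicator_of_notMem (fun hp => hp3 ⟨⟨hp1, ?_⟩, hp2⟩) _
      have := hW _ hp
      rwa [norm_smul_unitVec (le_of_lt hp1)] at this
  have hswap : IntegrableOn (fun q : ℝ × ℝ => F q.swap)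
      (Ioo (-Real.pi) Real.pi ×ˢ Ioi (0 : ℝ)) := by
    rw [IntegrableOn, Measure.volume_eq_prod, ← Measure.prod_restrict] at hint ⊢
    exact hint.swap
  have hinner : ∀ θ, ∫ s in Ioi (0 : ℝ), F (s, θ) =
      ∫ s in {s : ℝ | 0 < s ∧ s • unitVec θ ∈ Ω}, s * g s := by
    intro θ
    have hms : MeasurableSet {s : ℝ | s • unitVec θ ∈ Ω} :=
      (continuous_id.smul continuous_const).measurable hm
    exact (setIntegral_indicator hms (f := fun s : ℝ => s * g s))
  constructor
  · rw [IntegrableOn, Measure.volume_eq_prod, ← Measure.prod_restrict] at hswap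
    exact hswap.integral_prod_left.congr (Eventually.of_forall hinner)
  · rw [← integral_indicator hm, integral_polar_euclideanSpace]
    calc _ = ∫ p in Ioi (0 : ℝ) ×ˢ Ioo (-Real.pi) Real.pi, F p := by
          refine setIntegral_congr_fun (measurableSet_Ioi.prod measurableSet_Ioo) fun p hp => ?_
          by_cases h : p.1 • unitVec p.2 ∈ Ω
          · have h' : p ∈ {p : ℝ × ℝ | p.1 • unitVec p.2 ∈ Ω} := h
            simp only [hF, indicator_of_mem h, indicator_of_mem h',
              norm_smul_unitVec (le_of_lt hp.1)]
          · have h' : p ∉ {p : ℝ × ℝ | p.1 • unitVec p.2 ∈ Ω} := h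
            simp only [hF, indicator_of_notMem h, indicator_of_notMem h', mul_zero]
      _ = ∫ q in Ioo (-Real.pi) Real.pi ×ˢ Ioi (0 : ℝ), F q.swap := by
          rw [Measure.volume_eq_prod]
          exact (setIntegral_prod_swap _ _ F).symm
      _ = ∫ θ in Ioo (-Real.pi) Real.pi, ∫ s in Ioi (0 : ℝ), F (s, θ) := by
          rw [Measure.volume_eq_prod] at hswap ⊢
          exact setIntegral_prod _ hswap
      _ = _ := by simp_rw [hinner]

/-! ### The cosine transform and its circular means -/

/-- The cosine transform of the characteristic function of `Ω`. -/
noncomputable def cosInt {d : ℕ} (Ω : Set (EuclideanSpace ℝ (Fin d))) (ξ : EuclideanSpace ℝ (Fin d)) : ℝ :=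
  ∫ x in Ω, Real.cos (inner ℝ ξ x)

theorem integrableOn_of_continuous_of_isBounded {d : ℕ} {Ω : Set (EuclideanSpace ℝ (Fin d))}
    (hb : Bornology.IsBounded Ω) {E : Type*} [NormedAddCommGroup E]
    {f : EuclideanSpace ℝ (Fin d) → E} (hf : Continuous f) : IntegrableOn f Ω :=
  (hf.continuousOn.integrableOn_compact hb.isCompact_closure).mono_set subset_closure

theorem charFourier_eq_cosInt {d : ℕ} {Ω : Set (EuclideanSpace ℝ (Fin d))}
    (hb : Bornology.IsBounded Ω) (hbal : IsBalancedSet Ω) (ξ : EuclideanSpace ℝ (Fin d)) :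
    charFourier Ω ξ = (cosInt Ω ξ : ℂ) := by
  have hpre : (fun x : EuclideanSpace ℝ (Fin d) => -x) ⁻¹' Ω = Ω := by
    conv_lhs => rw [← hbal]
    exact preimage_image_eq _ neg_injective
  have hsin : ∫ x in Ω, Real.sin (inner ℝ ξ x) = 0 := by
    have h := (Measure.measurePreserving_neg
      (volume : Measure (EuclideanSpace ℝ (Fin d)))).setIntegral_preimage_emb
      (MeasurableEquiv.neg _).measurableEmbedding (fun x => Real.sin (inner ℝ ξ x)) Ω
    have h' : ∫ x in Ω, Real.sin (inner ℝ ξ (-x)) = ∫ x in Ω, Real.sin (inner ℝ ξ x) := by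
      rw [← h]
      exact (congrArg (fun S => ∫ x in S, Real.sin (inner ℝ ξ (-x))) hpre).symm
    simp only [inner_neg_right, Real.sin_neg, integral_neg] at h'
    linarith
  have hc : IntegrableOn (fun x => ((Real.cos (inner ℝ ξ x) : ℝ) : ℂ)) Ω :=
    integrableOn_of_continuous_of_isBounded hb (by fun_prop)
  have hs : IntegrableOn (fun x => ((Real.sin (inner ℝ ξ x) : ℝ) : ℂ) * Complex.I) Ω :=
    integrableOn_of_continuous_of_isBounded hb (by fun_prop)
  have e : ∀ x : EuclideanSpace ℝ (Fin d), Complex.exp (Complex.I * ((inner ℝ ξ x : ℝ) : ℂ)) =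
      ((Real.cos (inner ℝ ξ x) : ℝ) : ℂ) + ((Real.sin (inner ℝ ξ x) : ℝ) : ℂ) * Complex.I := by
    intro x
    rw [mul_comm, Complex.exp_mul_I]
    push_cast
    rfl
  unfold charFourier cosInt
  simp_rw [e]
  rw [integral_add hc hs, integral_mul_const, integral_complex_ofReal, integral_complex_ofReal,
    hsin]
  simp

theorem continuous_cosInt {d : ℕ} {Ω : Set (EuclideanSpace ℝ (Fin d))}
    (hb : Bornology.IsBounded Ω) : Continuous (cosInt Ω) := by
  have hfin : IntegrableOn (fun _ => (1 : ℝ)) Ω :=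
    integrableOn_of_continuous_of_isBounded hb continuous_const
  refine continuous_of_dominated (bound := fun _ => 1)
    (fun ξ => (by fun_prop : Continuous fun x => Real.cos (inner ℝ ξ x)).aestronglyMeasurable)
    (fun ξ => Eventually.of_forall fun x => ?_) hfin (Eventually.of_forall fun x => by fun_prop)
  exact Real.abs_cos_le_one _

/-- The transform is nonnegative at the origin, so the intermediate value theorem gives a zero on
the segment from 0 to `ξ`. -/
theorem kappa_le_of_cosInt_nonpos {d : ℕ} {Ω : Set (EuclideanSpace ℝ (Fin d))}
    (hb : Bornology.IsBounded Ω) (hbal : IsBalancedSet Ω) {ξ : EuclideanSpace ℝ (Fin d)}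
    (h : cosInt Ω ξ ≤ 0) : kappa Ω ≤ ENNReal.ofReal ‖ξ‖ := by
  have h0 : 0 ≤ cosInt Ω ((0 : ℝ) • ξ) := by
    simp only [cosInt, zero_smul, inner_zero_left, Real.cos_zero]
    exact integral_nonneg fun _ => zero_le_one
  have hcont : Continuous fun s : ℝ => cosInt Ω (s • ξ) :=
    (continuous_cosInt hb).comp (by fun_prop)
  obtain ⟨s, hs, hs0⟩ := intermediate_value_Icc' (zero_le_one' ℝ) hcont.continuousOn
    ⟨by simpa using h, h0⟩
  have hmem : s • ξ ∈ realNullVariety Ω := by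
    change charFourier Ω _ = 0
    rw [charFourier_eq_cosInt hb hbal]
    exact_mod_cast hs0
  refine (iInf₂_le _ hmem).trans (ENNReal.ofReal_le_ofReal ?_)
  rw [norm_smul, Real.norm_of_nonneg hs.1]
  exact mul_le_of_le_one_left (norm_nonneg _) hs.2

theorem cosInt_image_linearIsometryEquiv {d : ℕ} (Ω : Set (EuclideanSpace ℝ (Fin d)))
    (A : EuclideanSpace ℝ (Fin d) ≃ₗᵢ[ℝ] EuclideanSpace ℝ (Fin d))
    (ξ : EuclideanSpace ℝ (Fin d)) : cosInt (A '' Ω) (A ξ) = cosInt Ω ξ := by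
  unfold cosInt
  rw [A.measurePreserving.setIntegral_image_emb A.toMeasurableEquiv.measurableEmbedding]
  simp only [LinearIsometryEquiv.inner_map_map]

theorem integral_cosInt_circle {Ω : Set (EuclideanSpace ℝ (Fin 2))}
    (hb : Bornology.IsBounded Ω) (r : ℝ) :
    ∫ φ in (-Real.pi)..Real.pi, cosInt Ω (r • unitVec φ) =
      2 * Real.pi * ∫ x in Ω, besselJ 0 (r * ‖x‖) := by
  have hfin : IsFiniteMeasure (volume.restrict Ω) := ⟨by simpa using hb.measure_lt_top⟩
  have hpi : -Real.pi ≤ Real.pi := by linarith [Real.pi_pos]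
  have hc : Continuous fun p : ℝ × EuclideanSpace ℝ (Fin 2) =>
      Real.cos (inner ℝ (r • unitVec p.1) p.2) := by
    have := continuous_unitVec
    fun_prop
  rw [intervalIntegral.integral_of_le hpi]
  unfold cosInt
  rw [integral_integral_swap, ← integral_const_mul]
  · refine integral_congr_ae (Eventually.of_forall fun x => ?_)
    dsimp only
    rw [← intervalIntegral.integral_of_le hpi]
    have e : ∀ φ : ℝ, inner ℝ (r • unitVec φ) x =
        (r * x 0) * Real.cos φ + (r * x 1) * Real.sin φ := by
      intro φ
      simp [unitVec, PiLp.inner_apply, Fin.sum_univ_two]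
      ring
    simp_rw [e]
    rw [integral_cos_mul_cos_add_mul_sin]
    have h1 : (r * x 0) ^ 2 + (r * x 1) ^ 2 = (|r| * ‖x‖) ^ 2 := by
      rw [mul_pow |r|, sq_abs, EuclideanSpace.norm_sq_eq, Fin.sum_univ_two, Real.norm_eq_abs,
        Real.norm_eq_abs, sq_abs, sq_abs]
      ring
    -- `J_0` is even, so `|r|` may be replaced by `r`.
    rw [h1, Real.sqrt_sq (by positivity), besselJ_eq_besselSeries, besselJ_eq_besselSeries,
      pow_zero, pow_zero, div_pow, div_pow, mul_pow, mul_pow, sq_abs]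
  · refine Integrable.of_bound hc.aestronglyMeasurable 1 (Eventually.of_forall fun p => ?_)
    exact Real.abs_cos_le_one _

/-! ### A full cosine period against a concave function -/

theorem integral_cos_mul_affine {T : ℝ} (hT : 0 < T) (α β : ℝ) :
    ∫ t in (0 : ℝ)..T, Real.cos (2 * Real.pi / T * t) * (α + β * t) = 0 := by
  set k := 2 * Real.pi / T with hk
  have hk0 : k ≠ 0 := by positivity
  have hkT : k * T = 2 * Real.pi := by rw [hk]; field_simp
  have hd : ∀ t ∈ uIcc 0 T, HasDerivAt
      (fun t => (α + β * t) * (Real.sin (k * t) / k) + β * (Real.cos (k * t) / k ^ 2))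
      (Real.cos (k * t) * (α + β * t)) t := by
    intro t _
    have h1 : HasDerivAt (fun t : ℝ => k * t) k t := by
      simpa using (hasDerivAt_id t).const_mul k
    have h2 : HasDerivAt (fun t : ℝ => α + β * t) β t := by
      simpa using ((hasDerivAt_id t).const_mul β).const_add α
    convert! (h2.mul (h1.sin.div_const k)).add ((h1.cos.div_const (k ^ 2)).const_mul β) using 1
    field_simp
    ring
  rw [intervalIntegral.integral_eq_sub_of_hasDerivAt hd
    ((by fun_prop : Continuous fun t : ℝ => Real.cos (k * t) * (α + β * t)).intervalIntegrable
      _ _), hkT]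
  simp

/-- Integrated against one full period of the cosine, a concave function gives a nonpositive
value. -/
theorem integral_cos_mul_concave_nonpos {T : ℝ} (hT : 0 < T) {l : ℝ → ℝ}
    (hl : ConcaveOn ℝ (Ioo 0 T) l) (hi : IntervalIntegrable l volume 0 T) :
    ∫ t in (0 : ℝ)..T, Real.cos (2 * Real.pi / T * t) * l t ≤ 0 := by
  have hchord : ∀ {x y z : ℝ}, x ∈ Ioo 0 T → z ∈ Ioo 0 T → x ≤ y → y ≤ z → x < z →
      (z - y) * l x + (y - x) * l z ≤ (z - x) * l y := by
    intro x y z hx hz hxy hyz hxz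
    have hd : 0 < z - x := sub_pos.2 hxz
    obtain ⟨-, hl2⟩ := hl
    have h := hl2 hx hz (a := (z - y) / (z - x)) (b := (y - x) / (z - x))
      (div_nonneg (by linarith) hd.le) (div_nonneg (by linarith) hd.le)
      (by rw [← add_div, div_eq_one_iff_eq hd.ne']; ring)
    simp only [smul_eq_mul] at h
    rw [show (z - y) / (z - x) * x + (y - x) / (z - x) * z = y by
      rw [div_mul_eq_mul_div, div_mul_eq_mul_div, ← add_div, div_eq_iff hd.ne']; ring] at h
    calc (z - y) * l x + (y - x) * l z
        = (z - x) * ((z - y) / (z - x) * l x + (y - x) / (z - x) * l z) := by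
          field_simp
      _ ≤ (z - x) * l y := by gcongr
  -- The chord through the graph of `l` at the two zeros `T/4` and `3T/4` of the cosine. By
  -- concavity `l` lies above it between them, where the cosine is nonpositive, and below it
  -- outside, where the cosine is nonnegative. Replacing `l` by the chord thus only increases the
  -- integrand, and the chord integrates to zero.
  obtain ⟨α, β, h1, h2⟩ : ∃ α β : ℝ, l (T / 4) = α + β * (T / 4) ∧
      l (3 * T / 4) = α + β * (3 * T / 4) :=
    ⟨(3 * l (T / 4) - l (3 * T / 4)) / 2, 2 * (l (3 * T / 4) - l (T / 4)) / T,
      by field_simp; ring, by field_simp; ring⟩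
  have hc : ContinuousOn (fun t : ℝ => Real.cos (2 * Real.pi / T * t)) (uIcc 0 T) := by fun_prop
  refine le_of_le_of_eq ?_ (integral_cos_mul_affine hT α β)
  refine intervalIntegral.integral_mono_on_of_le_Ioo hT.le (hi.continuousOn_mul hc)
    ((by fun_prop : Continuous fun t : ℝ =>
      Real.cos (2 * Real.pi / T * t) * (α + β * t)).intervalIntegrable _ _) fun t ht => ?_
  have hp := Real.pi_pos
  have hq : T / 4 ∈ Ioo 0 T := ⟨by linarith, by linarith⟩
  have hq' : 3 * T / 4 ∈ Ioo 0 T := ⟨by linarith, by linarith⟩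
  have hkt : ∀ c : ℝ, 2 * Real.pi / T * (c * T) = c * (2 * Real.pi) := by
    intro c; field_simp
  have hmono : ∀ {a b : ℝ}, a ≤ b → 2 * Real.pi / T * a ≤ 2 * Real.pi / T * b := fun h =>
    mul_le_mul_of_nonneg_left h (by positivity)
  rcases le_or_gt t (T / 4) with h | h
  · have hcos : 0 ≤ Real.cos (2 * Real.pi / T * t) := by
      have e1 := hmono h
      have e2 := hmono ht.1.le
      rw [show T / 4 = (1 / 4) * T by ring, hkt] at e1
      exact Real.cos_nonneg_of_neg_pi_div_two_le_of_le (by linarith) (by linarith)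
    refine mul_le_mul_of_nonneg_left ?_ hcos
    have h3 := hchord ht hq' h (by linarith) (by linarith)
    rw [h1, h2] at h3
    refine le_of_mul_le_mul_left (a := T / 2) ?_ (by positivity)
    linarith
  rcases le_or_gt t (3 * T / 4) with h' | h'
  · have hcos : Real.cos (2 * Real.pi / T * t) ≤ 0 := by
      have e1 := hmono h.le
      have e2 := hmono h'
      rw [show T / 4 = (1 / 4) * T by ring, hkt] at e1
      rw [show 3 * T / 4 = (3 / 4) * T by ring, hkt] at e2
      exact Real.cos_nonpos_of_pi_div_two_le_of_le (by linarith) (by linarith)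
    refine mul_le_mul_of_nonpos_left ?_ hcos
    have h3 := hchord hq hq' h.le h' (by linarith)
    rw [h1, h2] at h3
    refine le_of_mul_le_mul_left (a := T / 2) ?_ (by positivity)
    linarith
  · have hcos : 0 ≤ Real.cos (2 * Real.pi / T * t) := by
      have e1 := hmono h'.le
      have e2 := hmono ht.2.le
      rw [show 3 * T / 4 = (3 / 4) * T by ring, hkt] at e1
      have e3 := hkt 1
      rw [one_mul, one_mul] at e3
      rw [← Real.cos_sub_two_pi]
      exact Real.cos_nonneg_of_neg_pi_div_two_le_of_le (by linarith) (by linarith)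
    refine mul_le_mul_of_nonneg_left ?_ hcos
    have h3 := hchord hq ht (by linarith) h'.le h
    rw [h1, h2] at h3
    refine le_of_mul_le_mul_left (a := T / 2) ?_ (by positivity)
    linarith

/-! ### Lengths of sections of a planar convex set -/

theorem Convex.volume_real_eq_csSup_sub_csInf {S : Set ℝ} (hc : Convex ℝ S) (hne : S.Nonempty)
    (hb : Bornology.IsBounded S) : volume.real S = sSup S - sInf S := by
  obtain ⟨h1, h2⟩ := isBounded_iff_bddBelow_bddAbove.1 hb
  have hle : sInf S ≤ sSup S := csInf_le_csSup hne h1 h2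
  refine le_antisymm ?_ ?_
  · rw [← Real.volume_real_Icc_of_le hle]
    exact measureReal_mono (subset_Icc_csInf_csSup h1 h2) (by simp)
  · rw [← Real.volume_real_Ioo_of_le hle]
    exact measureReal_mono
      (IsConnected.Ioo_csInf_csSup_subset ⟨hne, hc.isPreconnected⟩ h1 h2)
      hb.measure_lt_top.ne

open scoped Pointwise in
/-- The one-dimensional Brunn–Minkowski inequality for convex sets. -/
theorem Convex.add_volume_real_le {S T U : Set ℝ} (hS : Convex ℝ S) (hT : Convex ℝ T)
    (hU : Convex ℝ U) (hS0 : S.Nonempty) (hT0 : T.Nonempty) (hSb : Bornology.IsBounded S)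
    (hTb : Bornology.IsBounded T) (hUb : Bornology.IsBounded U) {a b : ℝ} (ha : 0 ≤ a)
    (hb : 0 ≤ b) (h : a • S + b • T ⊆ U) :
    a * volume.real S + b * volume.real T ≤ volume.real U := by
  have hne : (a • S + b • T).Nonempty := (hS0.smul_set).add hT0.smul_set
  have hS1 := isBounded_iff_bddBelow_bddAbove.1 (hSb.smul₀ a)
  have hT1 := isBounded_iff_bddBelow_bddAbove.1 (hTb.smul₀ b)
  have hU1 := isBounded_iff_bddBelow_bddAbove.1 hUb
  have h1 := csSup_le_csSup hU1.2 hne h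
  have h2 := csInf_le_csInf hU1.1 hne h
  rw [csSup_add hS0.smul_set hS1.2 hT0.smul_set hT1.2, Real.sSup_smul_of_nonneg ha,
    Real.sSup_smul_of_nonneg hb] at h1
  rw [csInf_add hS0.smul_set hS1.1 hT0.smul_set hT1.1, Real.sInf_smul_of_nonneg ha,
    Real.sInf_smul_of_nonneg hb] at h2
  simp only [smul_eq_mul] at h1 h2
  rw [hS.volume_real_eq_csSup_sub_csInf hS0 hSb, hT.volume_real_eq_csSup_sub_csInf hT0 hTb,
    hU.volume_real_eq_csSup_sub_csInf (hne.mono h) hUb]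
  linarith

/-- The length of the section of `Ω` at first coordinate `t`. -/
noncomputable def sectionLength (Ω : Set (EuclideanSpace ℝ (Fin 2))) (t : ℝ) : ℝ :=
  volume.real {y : ℝ | !₂[t, y] ∈ Ω}

theorem continuous_euclideanSpace_pair :
    Continuous fun p : ℝ × ℝ => (!₂[p.1, p.2] : EuclideanSpace ℝ (Fin 2)) := by
  refine (PiLp.continuous_toLp 2 _).comp (continuous_pi fun i => ?_)
  fin_cases i
  · exact continuous_fst
  · exact continuous_snd

theorem smul_pair_add_smul_pair (a b t u y z : ℝ) :
    a • (!₂[t, y] : EuclideanSpace ℝ (Fin 2)) + b • !₂[u, z] =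
      !₂[a * t + b * u, a * y + b * z] := by
  ext i
  fin_cases i <;> simp

theorem isBounded_section {Ω : Set (EuclideanSpace ℝ (Fin 2))} (hb : Bornology.IsBounded Ω)
    (t : ℝ) : Bornology.IsBounded {y : ℝ | !₂[t, y] ∈ Ω} := by
  obtain ⟨W, hW⟩ := hb.exists_norm_le
  refine isBounded_iff_forall_norm_le.2 ⟨W, fun y hy => ?_⟩
  exact (PiLp.norm_apply_le (!₂[t, y] : EuclideanSpace ℝ (Fin 2)) 1).trans (hW _ hy)

/-- A convex combination of two sections lies in the section at the combined coordinate, so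
one-dimensional Brunn–Minkowski applies; that inequality needs nonempty sections. -/
theorem concaveOn_sectionLength {Ω : Set (EuclideanSpace ℝ (Fin 2))}
    (hb : Bornology.IsBounded Ω) (hc : Convex ℝ Ω) {I : Set ℝ} (hI : Convex ℝ I)
    (hne : ∀ t ∈ I, {y : ℝ | !₂[t, y] ∈ Ω}.Nonempty) : ConcaveOn ℝ I (sectionLength Ω) := by
  have hconv : ∀ t, Convex ℝ {y : ℝ | !₂[t, y] ∈ Ω} := by
    intro t y hy z hz a b ha hb' hab
    have := hc hy hz ha hb' hab
    rw [smul_pair_add_smul_pair, ← add_mul, hab, one_mul] at this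
    exact this
  refine ⟨hI, fun t ht u hu a b ha hb' hab => ?_⟩
  refine (hconv t).add_volume_real_le (hconv u) (hconv _) (hne t ht) (hne u hu)
    (isBounded_section hb t) (isBounded_section hb u) (isBounded_section hb _) ha hb' ?_
  rintro _ ⟨_, ⟨y, hy, rfl⟩, _, ⟨z, hz, rfl⟩, rfl⟩
  have := hc hy hz ha hb' hab
  rw [smul_pair_add_smul_pair] at this
  exact this

theorem integral_sectionLength {Ω : Set (EuclideanSpace ℝ (Fin 2))} (hm : MeasurableSet Ω)
    (hb : Bornology.IsBounded Ω) {g : ℝ → ℝ} (hg : Continuous g) :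
    Integrable (fun t => g t * sectionLength Ω t) ∧
      ∫ x in Ω, g (x 0) = ∫ t, g t * sectionLength Ω t := by
  have hmp : MeasurableSet {p : ℝ × ℝ | !₂[p.1, p.2] ∈ Ω} :=
    continuous_euclideanSpace_pair.measurable hm
  set F : ℝ × ℝ → ℝ := ({p : ℝ × ℝ | !₂[p.1, p.2] ∈ Ω}).indicator fun p => g p.1 with hF
  obtain ⟨W, hW⟩ := hb.exists_norm_le
  have hbox : {p : ℝ × ℝ | !₂[p.1, p.2] ∈ Ω} ⊆ Icc (-W) W ×ˢ Icc (-W) W := by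
    intro p hp
    have h0 := (PiLp.norm_apply_le (!₂[p.1, p.2] : EuclideanSpace ℝ (Fin 2)) 0).trans (hW _ hp)
    have h1 := (PiLp.norm_apply_le (!₂[p.1, p.2] : EuclideanSpace ℝ (Fin 2)) 1).trans (hW _ hp)
    exact ⟨abs_le.1 h0, abs_le.1 h1⟩
  have hFi : Integrable F := by
    refine IntegrableOn.integrable_indicator ?_ hmp
    exact ((by fun_prop : Continuous fun p : ℝ × ℝ => g p.1).continuousOn.integrableOn_compact
      (isCompact_Icc.prod isCompact_Icc)).mono_set hbox
  have hinner : ∀ t, ∫ y, F (t, y) = g t * sectionLength Ω t := by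
    intro t
    have hms : MeasurableSet {y : ℝ | !₂[t, y] ∈ Ω} := measurable_prodMk_left hmp
    have h := integral_indicator_const (μ := volume) (g t) hms
    rw [smul_eq_mul, mul_comm] at h
    exact h
  have hFi' := hFi
  rw [Measure.volume_eq_prod] at hFi'
  constructor
  · exact hFi'.integral_prod_left.congr (Eventually.of_forall hinner)
  · rw [← integral_indicator hm, integral_euclideanSpace_fin_two]
    calc _ = ∫ p, F p := by
          refine integral_congr_ae (Eventually.of_forall fun p => ?_)
          by_cases h : !₂[p.1, p.2] ∈ Ω
          · have h' : p ∈ {p : ℝ × ℝ | !₂[p.1, p.2] ∈ Ω} := h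
            simp only [hF, indicator_of_mem h, indicator_of_mem h']
            rfl
          · have h' : p ∉ {p : ℝ × ℝ | !₂[p.1, p.2] ∈ Ω} := h
            simp only [hF, indicator_of_notMem h, indicator_of_notMem h']
      _ = ∫ t, ∫ y, F (t, y) := by
          rw [Measure.volume_eq_prod, integral_prod F hFi']
      _ = _ := by simp_rw [hinner]

theorem neg_mem_of_isBalancedSet {d : ℕ} {Ω : Set (EuclideanSpace ℝ (Fin d))}
    (hbal : IsBalancedSet Ω) {x : EuclideanSpace ℝ (Fin d)} (hx : x ∈ Ω) : -x ∈ Ω := by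
  rw [← hbal]
  exact mem_image_of_mem _ hx

/-! ### Long bodies -/

theorem cosInt_axis_nonpos {Ω : Set (EuclideanSpace ℝ (Fin 2))} (ho : IsOpen Ω)
    (hb : Bornology.IsBounded Ω) (hc : Convex ℝ Ω) (hbal : IsBalancedSet Ω) {h : ℝ} (hh : 0 < h)
    (hle : ∀ x ∈ Ω, ‖x‖ ≤ h) (hcl : (!₂[h, 0] : EuclideanSpace ℝ (Fin 2)) ∈ closure Ω) :
    cosInt Ω ((2 * Real.pi / h) • !₂[1, 0]) ≤ 0 := by
  have hsec : ∀ t ∈ Ioo (-h) h, {y : ℝ | !₂[t, y] ∈ Ω}.Nonempty := by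
    intro t ht
    have habs : |t| < h := abs_lt.2 ht
    -- Points of `Ω` near `(h, 0)` and their negatives project to both sides of `t`; the projection
    -- of `Ω` is connected, so it contains `t`.
    obtain ⟨x, hx, hxt⟩ : ∃ x ∈ Ω, |t| < x 0 := by
      have hU : IsOpen {x : EuclideanSpace ℝ (Fin 2) | |t| < x 0} :=
        isOpen_lt continuous_const (by fun_prop)
      obtain ⟨x, hx1, hx2⟩ := mem_closure_iff.1 hcl _ hU (by simpa using habs)
      exact ⟨x, hx2, hx1⟩
    have himg : OrdConnected ((fun x : EuclideanSpace ℝ (Fin 2) => x 0) '' Ω) :=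
      (hc.isPreconnected.image _ (by fun_prop : Continuous fun x : EuclideanSpace ℝ (Fin 2) =>
        x 0).continuousOn).ordConnected
    obtain ⟨z, hz, hzt⟩ := himg.out
      ⟨-x, neg_mem_of_isBalancedSet hbal hx, rfl⟩ ⟨x, hx, rfl⟩
      (show t ∈ Icc ((-x) 0) (x 0) from
        ⟨by rw [PiLp.neg_apply]; linarith [neg_abs_le t], by linarith [le_abs_self t]⟩)
    refine ⟨z 1, ?_⟩
    have e : (!₂[t, z 1] : EuclideanSpace ℝ (Fin 2)) = z := by
      ext i
      fin_cases i
      · exact hzt.symm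
      · rfl
    rw [mem_ofPred_eq, e]
    exact hz
  have hcat := concaveOn_sectionLength hb hc (convex_Ioo (-h) h) hsec
  obtain ⟨-, hcat2⟩ := id hcat
  have hr : ConcaveOn ℝ (Ioo 0 h) (sectionLength Ω) :=
    hcat.subset (Ioo_subset_Ioo_left (by linarith)) (convex_Ioo 0 h)
  have hl : ConcaveOn ℝ (Ioo 0 h) fun t => sectionLength Ω (-t) := by
    refine ⟨convex_Ioo 0 h, fun t ht u hu a b ha hb' hab => ?_⟩
    have := hcat2 (x := -t) ⟨by linarith [ht.2], by linarith [ht.1]⟩ (y := -u)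
      ⟨by linarith [hu.2], by linarith [hu.1]⟩ ha hb' hab
    rw [smul_neg, smul_neg, ← neg_add] at this
    exact this
  obtain ⟨hi, heq⟩ := integral_sectionLength ho.measurableSet hb
    (g := fun t => Real.cos (2 * Real.pi / h * t)) (by fun_prop)
  have hi1 := (integral_sectionLength ho.measurableSet hb (g := fun _ => 1) continuous_const).1
  simp only [one_mul] at hi1
  have hzero : ∀ t ∉ Icc (-h) h, sectionLength Ω t = 0 := by
    intro t ht
    have : {y : ℝ | !₂[t, y] ∈ Ω} = ∅ := by
      refine eq_empty_of_forall_notMem fun y hy => ht ?_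
      exact abs_le.1 ((PiLp.norm_apply_le (!₂[t, y] : EuclideanSpace ℝ (Fin 2)) 0).trans
        (hle _ hy))
    rw [sectionLength, this, measureReal_empty]
  have e1 : cosInt Ω ((2 * Real.pi / h) • !₂[1, 0]) =
      ∫ x in Ω, Real.cos (2 * Real.pi / h * x 0) := by
    unfold cosInt
    congr 1
    ext x
    simp [PiLp.inner_apply, Fin.sum_univ_two, mul_comm]
  rw [e1, heq, ← setIntegral_eq_integral_of_forall_compl_eq_zero (s := Icc (-h) h)
    (fun t ht => by rw [hzero t ht, mul_zero]), integral_Icc_eq_integral_Ioc,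
    ← intervalIntegral.integral_of_le (by linarith),
    ← intervalIntegral.integral_add_adjacent_intervals (b := 0) hi.intervalIntegrable
      hi.intervalIntegrable]
  -- Each half of `[-h, h]` is one period; the left half is reflected onto `(0, h)`.
  have h1 := integral_cos_mul_concave_nonpos hh hr hi1.intervalIntegrable
  have h2 := integral_cos_mul_concave_nonpos hh hl (hi1.comp_neg).intervalIntegrable
  have h3 := intervalIntegral.integral_comp_neg (a := 0) (b := h)
    fun t => Real.cos (2 * Real.pi / h * t) * sectionLength Ω t
  simp only [mul_neg, Real.cos_neg, neg_zero] at h3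
  rw [h3] at h2
  linarith

theorem kappa_le_two_pi_div {Ω : Set (EuclideanSpace ℝ (Fin 2))} (ho : IsOpen Ω)
    (hb : Bornology.IsBounded Ω) (hc : Convex ℝ Ω) (hbal : IsBalancedSet Ω)
    {x₀ : EuclideanSpace ℝ (Fin 2)} (h0 : x₀ ≠ 0) (hx₀ : x₀ ∈ closure Ω)
    (hle : ∀ x ∈ Ω, ‖x‖ ≤ ‖x₀‖) : kappa Ω ≤ ENNReal.ofReal (2 * Real.pi / ‖x₀‖) := by
  have hh : 0 < ‖x₀‖ := norm_pos_iff.2 h0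
  set e : EuclideanSpace ℝ (Fin 2) := !₂[‖x₀‖, 0] with he
  have hnorm : ‖x₀‖ = ‖e‖ := by
    simp [he, EuclideanSpace.norm_eq, Fin.sum_univ_two]
  -- Reflection in the bisector of `x₀` and `e` moves the farthest point onto the first axis.
  set A := (Submodule.span ℝ {x₀ - e})ᗮ.reflection
  have hA : A x₀ = e := Submodule.reflection_sub hnorm
  have hu : ‖(!₂[1, 0] : EuclideanSpace ℝ (Fin 2))‖ = 1 := by
    simp [EuclideanSpace.norm_eq, Fin.sum_univ_two]
  set ξ := A.symm ((2 * Real.pi / ‖x₀‖) • !₂[1, 0]) with hξ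
  have hξn : ‖ξ‖ = 2 * Real.pi / ‖x₀‖ := by
    rw [hξ, LinearIsometryEquiv.norm_map, norm_smul, hu, mul_one,
      Real.norm_of_nonneg (by have := Real.pi_pos; positivity)]
  rw [← hξn]
  refine kappa_le_of_cosInt_nonpos hb hbal ?_
  rw [← cosInt_image_linearIsometryEquiv Ω A ξ, hξ, LinearIsometryEquiv.apply_symm_apply]
  refine cosInt_axis_nonpos ?_ ?_ ?_ ?_ hh ?_ ?_
  · exact A.toHomeomorph.isOpenMap Ω ho
  · exact A.lipschitz.isBounded_image hb
  · exact hc.linear_image A.toLinearEquiv.toLinearMap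
  · ext y
    constructor
    · rintro ⟨_, ⟨x, hx, rfl⟩, rfl⟩
      exact ⟨-x, neg_mem_of_isBalancedSet hbal hx, map_neg A x⟩
    · rintro ⟨x, hx, rfl⟩
      exact ⟨_, ⟨-x, neg_mem_of_isBalancedSet hbal hx, rfl⟩, by simp⟩
  · rintro _ ⟨x, hx, rfl⟩
    rw [LinearIsometryEquiv.norm_map]
    exact hle x hx
  · rw [← he, ← hA]
    exact image_closure_subset_closure_image A.continuous ⟨x₀, hx₀, rfl⟩

/-! ### Short bodies -/

theorem exists_ray_eq_Ioo {Ω : Set (EuclideanSpace ℝ (Fin 2))} (ho : IsOpen Ω)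
    (hc : Convex ℝ Ω) (h0 : 0 ∈ Ω) {W : ℝ} (hW : ∀ x ∈ Ω, ‖x‖ ≤ W) (θ : ℝ) :
    ∃ ρ ∈ Icc 0 W, {s : ℝ | 0 < s ∧ s • unitVec θ ∈ Ω} = Ioo 0 ρ := by
  set S := {s : ℝ | 0 < s ∧ s • unitVec θ ∈ Ω} with hS
  have hopen : IsOpen S :=
    isOpen_Ioi.inter (ho.preimage (by fun_prop : Continuous fun s : ℝ => s • unitVec θ))
  have hub : ∀ s ∈ S, s ≤ W := by
    rintro s ⟨hs, hs'⟩
    have := hW _ hs'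
    rwa [norm_smul_unitVec hs.le] at this
  have hW0 : 0 ≤ W := (norm_nonneg _).trans (hW 0 h0)
  refine ⟨sSup S, ⟨Real.sSup_nonneg fun s hs => hs.1.le, Real.sSup_le hub hW0⟩, ?_⟩
  ext s
  constructor
  · intro hs
    obtain ⟨ε, hε, hball⟩ := Metric.isOpen_iff.1 hopen s hs
    have hs' : s + ε / 2 ∈ S := hball (by
      rw [Metric.mem_ball, Real.dist_eq, add_sub_cancel_left, abs_of_pos (by positivity)]
      linarith)
    exact ⟨hs.1, lt_of_lt_of_le (by linarith) (le_csSup ⟨W, hub⟩ hs')⟩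
  · rintro ⟨hs0, hs1⟩
    -- For empty `S` the default `sSup ∅ = 0` would contradict `0 < s < sSup S`.
    have hne : S.Nonempty := by
      by_contra h
      rw [not_nonempty_iff_eq_empty.1 h, Real.sSup_empty] at hs1
      linarith
    obtain ⟨s', hs', hlt⟩ := exists_lt_of_lt_csSup hne hs1
    have := hc.smul_mem_of_zero_mem h0 hs'.2 (t := s / s')
      ⟨div_nonneg hs0.le hs'.1.le, (div_le_one hs'.1).2 hlt.le⟩
    rw [smul_smul, div_mul_cancel₀ _ hs'.1.ne'] at this
    exact ⟨hs0, this⟩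

theorem setIntegral_Ioo_mul_besselJ_zero {r : ℝ} (hr : 0 < r) {ρ : ℝ} (hρ : 0 ≤ ρ) :
    ∫ s in Ioo 0 ρ, s * besselJ 0 (r * s) = ρ * besselJ 1 (r * ρ) / r := by
  rw [← integral_Ioc_eq_integral_Ioo, ← intervalIntegral.integral_of_le hρ, eq_div_iff hr.ne',
    mul_comm, mul_integral_mul_besselJ_zero r hρ]

theorem integral_besselJ_le {Ω : Set (EuclideanSpace ℝ (Fin 2))} (ho : IsOpen Ω)
    (hb : Bornology.IsBounded Ω) (hc : Convex ℝ Ω) (h0 : 0 ∈ Ω) {r : ℝ} (hr : 0 < r)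
    (hW : ∀ x ∈ Ω, ‖x‖ ≤ 2 * Real.pi / r) :
    ∫ x in Ω, besselJ 0 (r * ‖x‖) ≤
      2 * Real.pi * (0.312 * besselFirstZero 0 ^ 2 / r ^ 2) - 0.156 * volume.real Ω := by
  have hJ := continuous_besselJ 0
  -- The added constant `0.156 = 2 · 0.078` carries the area along: it contributes `0.078 ρ²` on
  -- each ray, the quadratic term of the parabola bound.
  obtain ⟨hi, heq⟩ := setIntegral_radial ho.measurableSet hb
    (g := fun s => besselJ 0 (r * s) + 0.156) (by fun_prop)
  have hsplit : ∫ x in Ω, (besselJ 0 (r * ‖x‖) + 0.156) =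
      (∫ x in Ω, besselJ 0 (r * ‖x‖)) + 0.156 * volume.real Ω := by
    rw [integral_add (integrableOn_of_continuous_of_isBounded hb (by fun_prop))
      (integrableOn_of_continuous_of_isBounded hb continuous_const), setIntegral_const,
      smul_eq_mul, mul_comm (0.156 : ℝ)]
  rw [le_sub_iff_add_le, ← hsplit, heq]
  have hconst : ∫ _θ in Ioo (-Real.pi) Real.pi, 0.312 * besselFirstZero 0 ^ 2 / r ^ 2 =
      2 * Real.pi * (0.312 * besselFirstZero 0 ^ 2 / r ^ 2) := by
    rw [setIntegral_const, Real.volume_real_Ioo_of_le (by linarith [Real.pi_pos]), smul_eq_mul]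
    ring
  rw [← hconst]
  refine setIntegral_mono_on hi (integrableOn_const (by simp)) measurableSet_Ioo fun θ _ => ?_
  obtain ⟨ρ, ⟨hρ0, hρ⟩, hray⟩ := exists_ray_eq_Ioo ho hc h0 hW θ
  rw [hray]
  have hsp : ∫ s in Ioo 0 ρ, s * (besselJ 0 (r * s) + 0.156) =
      ρ * besselJ 1 (r * ρ) / r + 0.078 * ρ ^ 2 := by
    have hint : ∀ {f : ℝ → ℝ}, Continuous f → IntegrableOn f (Ioo 0 ρ) := fun hf =>
      (hf.continuousOn.integrableOn_compact (isCompact_Icc (a := 0) (b := ρ))).mono_set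
        Ioo_subset_Icc_self
    simp_rw [mul_add]
    rw [integral_add (hint (by fun_prop)) (hint (by fun_prop)),
      setIntegral_Ioo_mul_besselJ_zero hr hρ0, integral_mul_const,
      ← integral_Ioc_eq_integral_Ioo, ← intervalIntegral.integral_of_le hρ0, integral_id]
    ring
  rw [hsp]
  have ht : r * ρ ≤ 2 * Real.pi := by
    rw [le_div_iff₀ hr] at hρ
    linarith
  have := mul_besselJ_one_add_sq_le (mul_nonneg hr.le hρ0) ht
  rw [le_div_iff₀ (by positivity)]
  refine le_of_eq_of_le ?_ this
  field_simp

/-! ### The transform of the disk -/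

theorem cosInt_ball_eq_of_norm_eq {R : ℝ} {ξ η : EuclideanSpace ℝ (Fin 2)} (h : ‖ξ‖ = ‖η‖) :
    cosInt (Metric.ball 0 R) ξ = cosInt (Metric.ball 0 R) η := by
  set A := (Submodule.span ℝ {ξ - η})ᗮ.reflection
  have hA : A ξ = η := Submodule.reflection_sub h
  have := cosInt_image_linearIsometryEquiv (Metric.ball 0 R) A ξ
  rw [A.image_ball, map_zero, hA] at this
  exact this.symm

/-- By rotational symmetry the transform equals its mean over the circle through `ξ`. -/
theorem cosInt_ball {R : ℝ} (hR : 0 ≤ R) {ξ : EuclideanSpace ℝ (Fin 2)} (hξ : ξ ≠ 0) :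
    cosInt (Metric.ball 0 R) ξ = 2 * Real.pi * (R * besselJ 1 (‖ξ‖ * R) / ‖ξ‖) := by
  have hr : 0 < ‖ξ‖ := norm_pos_iff.2 hξ
  have hJ := continuous_besselJ 0
  have h1 := integral_cosInt_circle (Metric.isBounded_ball (x := (0 : EuclideanSpace ℝ (Fin 2)))
    (r := R)) ‖ξ‖
  have h2 : ∀ φ : ℝ, cosInt (Metric.ball 0 R) (‖ξ‖ • unitVec φ) =
      cosInt (Metric.ball 0 R) ξ := fun φ =>
    cosInt_ball_eq_of_norm_eq (norm_smul_unitVec hr.le φ)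
  simp_rw [h2] at h1
  rw [intervalIntegral.integral_const, smul_eq_mul, sub_neg_eq_add, ← two_mul] at h1
  rw [mul_left_cancel₀ (by have := Real.pi_pos; positivity) h1,
    (setIntegral_radial measurableSet_ball Metric.isBounded_ball
      (g := fun s => besselJ 0 (‖ξ‖ * s)) (by fun_prop)).2]
  have hray : ∀ θ : ℝ, {s : ℝ | 0 < s ∧ s • unitVec θ ∈ Metric.ball 0 R} = Ioo 0 R := by
    intro θ
    ext s
    refine and_congr_right fun hs => ?_
    rw [mem_ball_zero_iff, norm_smul_unitVec (le_of_lt hs)]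
  simp_rw [hray, setIntegral_Ioo_mul_besselJ_zero hr hR]
  rw [setIntegral_const, Real.volume_real_Ioo_of_le (by linarith [Real.pi_pos]), smul_eq_mul]
  ring

theorem le_kappa_ball {R : ℝ} (hR : 0 < R) :
    ENNReal.ofReal (besselFirstZero 1 / R) ≤
      kappa (Metric.ball (0 : EuclideanSpace ℝ (Fin 2)) R) := by
  refine le_iInf₂ fun ξ hξ => ENNReal.ofReal_le_ofReal ?_
  have hbal : IsBalancedSet (Metric.ball (0 : EuclideanSpace ℝ (Fin 2)) R) := by
    rw [IsBalancedSet, image_neg_eq_neg, neg_ball, neg_zero]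
  have h0 : cosInt (Metric.ball 0 R) ξ = 0 := by
    have : charFourier (Metric.ball 0 R) ξ = 0 := hξ
    rw [charFourier_eq_cosInt Metric.isBounded_ball hbal] at this
    exact_mod_cast this
  by_contra! hlt
  rcases eq_or_ne ξ 0 with rfl | hne
  · simp only [cosInt, inner_zero_left, Real.cos_zero, setIntegral_const, smul_eq_mul,
      mul_one] at h0
    exact (ENNReal.toReal_pos (Metric.measure_ball_pos volume _ hR).ne'
      measure_ball_lt_top.ne).ne' h0
  · have hr : 0 < ‖ξ‖ := norm_pos_iff.2 hne
    have hJ := besselJ_ne_zero_of_lt_besselFirstZero (mul_pos hr hR) ((lt_div_iff₀ hR).1 hlt)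
    rw [cosInt_ball hR.le hne] at h0
    have := Real.pi_pos
    exact (by positivity : 2 * Real.pi * (R * besselJ 1 (‖ξ‖ * R) / ‖ξ‖) ≠ 0) h0

/-! ### Combining the two cases -/

theorem kappa_le_two_mul_besselFirstZero_div {Ω : Set (EuclideanSpace ℝ (Fin 2))}
    (ho : IsOpen Ω) (hb : Bornology.IsBounded Ω) (hne : Ω.Nonempty) (hc : Convex ℝ Ω)
    (hbal : IsBalancedSet Ω) {R : ℝ} (hR : 0 < R) (hvol : volume.real Ω = Real.pi * R ^ 2) :
    kappa Ω ≤ ENNReal.ofReal (2 * besselFirstZero 0 / R) := by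
  have hpi := Real.pi_pos
  have hj : 0 < besselFirstZero 0 := by linarith [besselFirstZero_zero_mem.1]
  set r := 2 * besselFirstZero 0 / R with hr
  have hr0 : 0 < r := by positivity
  have h0 : (0 : EuclideanSpace ℝ (Fin 2)) ∈ Ω := by
    obtain ⟨x, hx⟩ := hne
    have := hc hx (neg_mem_of_isBalancedSet hbal hx) (a := 1 / 2) (b := 1 / 2)
      (by norm_num) (by norm_num) (by norm_num)
    simpa using this
  obtain ⟨x₀, hx₀, hmax⟩ := hb.isCompact_closure.exists_isMaxOn ⟨0, subset_closure h0⟩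
    continuous_norm.continuousOn
  have hle : ∀ x ∈ Ω, ‖x‖ ≤ ‖x₀‖ := fun x hx => hmax (subset_closure hx)
  rcases le_total (2 * Real.pi / r) ‖x₀‖ with hlong | hshort
  · have hpos : 0 < ‖x₀‖ := lt_of_lt_of_le (by positivity) hlong
    refine (kappa_le_two_pi_div ho hb hc hbal (norm_pos_iff.1 hpos) hx₀ hle).trans
      (ENNReal.ofReal_le_ofReal ?_)
    rw [div_le_iff₀ hr0] at hlong
    rw [div_le_iff₀ hpos]
    linarith
  · have hint : ∫ x in Ω, besselJ 0 (r * ‖x‖) ≤ 0 := by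
      refine (integral_besselJ_le ho hb hc h0 hr0 fun x hx =>
        (hle x hx).trans hshort).trans_eq ?_
      -- Both terms equal `0.156 π R²`; this equality determines `r = 2 j_{0,1}/R`.
      rw [hvol, hr]
      field_simp
      ring
    obtain ⟨φ, hφ⟩ : ∃ φ, cosInt Ω (r • unitVec φ) ≤ 0 := by
      by_contra! hpos
      have hcont : Continuous fun φ => cosInt Ω (r • unitVec φ) :=
        (continuous_cosInt hb).comp (continuous_unitVec.const_smul r)
      have := intervalIntegral.intervalIntegral_pos_of_pos
        (hcont.intervalIntegrable (-Real.pi) Real.pi) hpos (by linarith)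
      rw [integral_cosInt_circle hb] at this
      nlinarith
    have := kappa_le_of_cosInt_nonpos hb hbal hφ
    rwa [norm_smul_unitVec hr0.le] at this

end

theorem mainTheorem1 :
    |2 * besselFirstZero 0 / besselFirstZero 1 - 1.2552| ≤ 0.00005 ∧
    ∀ Ω : Set (EuclideanSpace ℝ (Fin 2)),
      IsOpen Ω → Bornology.IsBounded Ω → Ω.Nonempty → Convex ℝ Ω → IsBalancedSet Ω →
        kappa Ω ≤
          ENNReal.ofReal (2 * besselFirstZero 0 / besselFirstZero 1) * kappa (equivolBall Ω) := by
  refine ⟨abs_besselFirstZero_ratio_sub_le, fun Ω ho hb hne hc hbal => ?_⟩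
  have hfin : volume Ω ≠ ⊤ := hb.measure_lt_top.ne
  have hvol := volume_equivolBall two_ne_zero Ω hfin
  have h0 : 0 < volume Ω := ho.measure_pos volume hne
  unfold equivolBall at hvol ⊢
  set R := (volume Ω / volume (Metric.ball (0 : EuclideanSpace ℝ (Fin 2)) 1)).toReal ^
    (((2 : ℕ) : ℝ)⁻¹)
  have hR : 0 < R := by
    -- A ball of nonpositive radius is empty, whereas `Ω` has positive area.
    by_contra! h
    rw [Metric.ball_eq_empty.2 h, measure_empty] at hvol
    exact h0.ne hvol
  have hV : volume.real Ω = Real.pi * R ^ 2 := by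
    rw [measureReal_def, ← hvol, EuclideanSpace.volume_ball_fin_two, ENNReal.toReal_mul,
      ENNReal.toReal_pow, ENNReal.toReal_ofReal hR.le, ENNReal.toReal_ofReal Real.pi_pos.le,
      mul_comm]
  have hj0 : 0 < besselFirstZero 0 := by linarith [besselFirstZero_zero_mem.1]
  have hj1 : 0 < besselFirstZero 1 := by linarith [besselFirstZero_one_mem.1]
  calc kappa Ω ≤ ENNReal.ofReal (2 * besselFirstZero 0 / R) :=
        kappa_le_two_mul_besselFirstZero_div ho hb hne hc hbal hR hV
    _ = ENNReal.ofReal (2 * besselFirstZero 0 / besselFirstZero 1) *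
          ENNReal.ofReal (besselFirstZero 1 / R) := by
        rw [← ENNReal.ofReal_mul (by positivity)]
        congr 1
        field_simp
    _ ≤ _ := by gcongr; exact le_kappa_ball hR
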